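/- Let LJ$^+$ be Gentzen's intuitionistic sequent calculus LJ for first-order formulas without function symbols and object constants (connectives $\&,\vee,\neg,\supset$, quantifiers $\forall,\exists$, constants $\top,\bot$; sequents have at most one formula in the succedent; structural rules are thinning, contraction, exchange and cut), with the axioms $A\vdash A$, $\;\vdash\top$ and $\bot\vdash$, extended by the neutralization rule $$\frac{N,\Gamma\vdash\Lambda\qquad \neg N,\Gamma\vdash\Lambda}{\Gamma\vdash\Lambda}\qquad (N \text{ a propositional formula, i.e. built by propositional connectives from symbols of arity } 0 \text{ and } \top,\bot).$$ A formula $F$ is derivable in LJ$^+$ if the sequent $\vdash F$ has a derivation. Theorem (weak existence property). Suppose that $\exists x\,A(x)$ is derivable in LJ$^+$. Then there are $n\ge 1$ and variables $t_1,\dots,t_n$ such that $A(t_1)\vee\dots\vee A(t_n)$ is derivable in LJ$^+$. Moreover, the disjunction can be read off from a derivation without cut: the sequent $\vdash\exists x\,A(x)$ has a derivation in LJ$^+$ in which the cut rule does not occur, and for every such cut-free derivation the variables $t_1,\dots,t_n$ ($n\ge 1$) can be chosen so that each $A(t_i)$ is the succedent of the premise of an inference of that derivation by which $\exists x\,A(x)$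 is introduced in the succedent. -/

import Mathlib

namespace LJPlus

universe u

/-- Variables available under `n` quantifiers. Free and bound variables are kept apart, as in
Gentzen's calculus: free variables are named by natural numbers, and `bound i` refers to the
quantifier at depth `i`, counted from the outermost one. -/
inductive Var (n : ℕ) : Type
  | free (a : ℕ) : Var n
  | bound (i : Fin n) : Var n

/-- First-order formulas without function symbols and object constants, lying under `n`
quantifiers. `Sym k` is the type of symbols of arity `k`: the elements of `Sym 0` are the
propositional symbols, those of `Sym (k + 1)` are predicate symbols. A formula in the usual
sense is an element of `Formula Sym 0`; an element of `Formula Sym 1` is a formula `A(x)` in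
which the free places of the bound variable `x` are marked. -/
inductive Formula (Sym : ℕ → Type u) : ℕ → Type u
  | atom {n k : ℕ} (R : Sym k) (v : Fin k → Var n) : Formula Sym n
  | top {n : ℕ} : Formula Sym n
  | bot {n : ℕ} : Formula Sym n
  | and {n : ℕ} (A B : Formula Sym n) : Formula Sym n
  | or {n : ℕ} (A B : Formula Sym n) : Formula Sym n
  | neg {n : ℕ} (A : Formula Sym n) : Formula Sym n
  | imp {n : ℕ} (A B : Formula Sym n) : Formula Sym n
  | all {n : ℕ} (A : Formula Sym (n + 1)) : Formula Sym n
  | ex {n : ℕ} (A : Formula Sym (n + 1)) : Formula Sym n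

/-- Replace the outermost bound variable by the free variable `a`. -/
def Var.inst {n : ℕ} (a : ℕ) : Var (n + 1) → Var n
  | .free b => .free b
  | .bound i => Fin.cases (.free a) (fun j => .bound j) i

variable {Sym : ℕ → Type u}

namespace Formula

/-- `A.inst a` is `A(a)`: the outermost bound variable is replaced by the free variable `a`. -/
def inst (a : ℕ) : {n : ℕ} → Formula Sym (n + 1) → Formula Sym n
  | _, .atom R v => .atom R (fun i => (v i).inst a)
  | _, .top => .top
  | _, .bot => .bot
  | _, .and A B => .and (A.inst a) (B.inst a)
  | _, .or A B => .or (A.inst a) (B.inst a)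
  | _, .neg A => .neg (A.inst a)
  | _, .imp A B => .imp (A.inst a) (B.inst a)
  | _, .all A => .all (A.inst a)
  | _, .ex A => .ex (A.inst a)

/-- The free variable `a` occurs in the formula. -/
def Occurs (a : ℕ) : {n : ℕ} → Formula Sym n → Prop
  | _, .atom _ v => ∃ i, v i = .free a
  | _, .top => False
  | _, .bot => False
  | _, .and A B => A.Occurs a ∨ B.Occurs a
  | _, .or A B => A.Occurs a ∨ B.Occurs a
  | _, .neg A => A.Occurs a
  | _, .imp A B => A.Occurs a ∨ B.Occurs a
  | _, .all A => A.Occurs a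
  | _, .ex A => A.Occurs a

/-- Propositional formulas: built from propositional symbols (and the constants) by the
propositional connectives. -/
def IsPropositional : {n : ℕ} → Formula Sym n → Prop
  | _, .atom (k := k) _ _ => k = 0
  | _, .top => True
  | _, .bot => True
  | _, .and A B => A.IsPropositional ∧ B.IsPropositional
  | _, .or A B => A.IsPropositional ∧ B.IsPropositional
  | _, .neg A => A.IsPropositional
  | _, .imp A B => A.IsPropositional ∧ B.IsPropositional
  | _, .all _ => False
  | _, .ex _ => False

/-- `A.disj t [t₂, …, tₙ]` is `A(t) ∨ (A(t₂) ∨ (… ∨ A(tₙ)))`. -/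
def disj (A : Formula Sym 1) : ℕ → List ℕ → Formula Sym 0
  | t, [] => A.inst t
  | t, s :: ts => .or (A.inst t) (A.disj s ts)

end Formula

/-- Derivations (proof trees) of the sequent calculus LJ+. The antecedent is a finite sequence of
formulas, the succedent is a formula (`some A`) or empty (`none`). All constructors except
`neutralization` form Gentzen's LJ with the constants for truth and falsity. -/
inductive Derivation :
    List (Formula Sym 0) → Option (Formula Sym 0) → Type u
  | ax (A : Formula Sym 0) : Derivation [A] (some A)
  | topR : Derivation [] (some .top)
  | botL : Derivation [.bot] none
  | thinL {Γ Λ} (A : Formula Sym 0) (d : Derivation Γ Λ) : Derivation (A :: Γ) Λ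
  | thinR {Γ} (A : Formula Sym 0) (d : Derivation Γ none) : Derivation Γ (some A)
  | contr {A Γ Λ} (d : Derivation (A :: A :: Γ) Λ) : Derivation (A :: Γ) Λ
  | exch {Γ A B Δ Λ} (d : Derivation (Γ ++ A :: B :: Δ) Λ) : Derivation (Γ ++ B :: A :: Δ) Λ
  | cut {Γ Δ C Λ} (d : Derivation Γ (some C)) (e : Derivation (C :: Δ) Λ) : Derivation (Γ ++ Δ) Λ
  | andR {Γ A B} (d : Derivation Γ (some A)) (e : Derivation Γ (some B)) :
      Derivation Γ (some (.and A B))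
  | andL₁ {A Γ Λ} (B : Formula Sym 0) (d : Derivation (A :: Γ) Λ) : Derivation (.and A B :: Γ) Λ
  | andL₂ {B Γ Λ} (A : Formula Sym 0) (d : Derivation (B :: Γ) Λ) : Derivation (.and A B :: Γ) Λ
  | orL {A B Γ Λ} (d : Derivation (A :: Γ) Λ) (e : Derivation (B :: Γ) Λ) :
      Derivation (.or A B :: Γ) Λ
  | orR₁ {Γ A} (B : Formula Sym 0) (d : Derivation Γ (some A)) : Derivation Γ (some (.or A B))
  | orR₂ {Γ B} (A : Formula Sym 0) (d : Derivation Γ (some B)) : Derivation Γ (some (.or A B))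
  | negR {A Γ} (d : Derivation (A :: Γ) none) : Derivation Γ (some (.neg A))
  | negL {A Γ} (d : Derivation Γ (some A)) : Derivation (.neg A :: Γ) none
  | impR {A Γ B} (d : Derivation (A :: Γ) (some B)) : Derivation Γ (some (.imp A B))
  | impL {Γ A B Δ Λ} (d : Derivation Γ (some A)) (e : Derivation (B :: Δ) Λ) :
      Derivation (.imp A B :: (Γ ++ Δ)) Λ
  | allR {Γ} (F : Formula Sym 1) (a : ℕ) (hΓ : ∀ G ∈ Γ, ¬ G.Occurs a) (hF : ¬ F.Occurs a)
      (d : Derivation Γ (some (F.inst a))) : Derivation Γ (some (.all F))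
  | allL {Γ Λ} (F : Formula Sym 1) (a : ℕ) (d : Derivation (F.inst a :: Γ) Λ) :
      Derivation (.all F :: Γ) Λ
  | exR {Γ} (F : Formula Sym 1) (a : ℕ) (d : Derivation Γ (some (F.inst a))) :
      Derivation Γ (some (.ex F))
  | exL {Γ Λ} (F : Formula Sym 1) (a : ℕ) (hF : ¬ F.Occurs a) (hΓ : ∀ G ∈ Γ, ¬ G.Occurs a)
      (hΛ : ∀ G ∈ Λ, ¬ G.Occurs a) (d : Derivation (F.inst a :: Γ) Λ) :
      Derivation (.ex F :: Γ) Λ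
  | neutralization {Γ Λ} (N : Formula Sym 0) (hN : N.IsPropositional)
      (d : Derivation (N :: Γ) Λ) (e : Derivation (.neg N :: Γ) Λ) : Derivation Γ Λ

namespace Derivation

/-- The cut rule does not occur in the derivation. -/
def CutFree : {Γ : List (Formula Sym 0)} → {Λ : Option (Formula Sym 0)} → Derivation Γ Λ → Prop
  | _, _, .ax _ => True
  | _, _, .topR => True
  | _, _, .botL => True
  | _, _, .thinL _ d => d.CutFree
  | _, _, .thinR _ d => d.CutFree
  | _, _, .contr d => d.CutFree
  | _, _, .exch d => d.CutFree
  | _, _, .cut _ _ => False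
  | _, _, .andR d e => d.CutFree ∧ e.CutFree
  | _, _, .andL₁ _ d => d.CutFree
  | _, _, .andL₂ _ d => d.CutFree
  | _, _, .orL d e => d.CutFree ∧ e.CutFree
  | _, _, .orR₁ _ d => d.CutFree
  | _, _, .orR₂ _ d => d.CutFree
  | _, _, .negR d => d.CutFree
  | _, _, .negL d => d.CutFree
  | _, _, .impR d => d.CutFree
  | _, _, .impL d e => d.CutFree ∧ e.CutFree
  | _, _, .allR _ _ _ _ d => d.CutFree
  | _, _, .allL _ _ d => d.CutFree
  | _, _, .exR _ _ d => d.CutFree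
  | _, _, .exL _ _ _ _ _ d => d.CutFree
  | _, _, .neutralization _ _ d e => d.CutFree ∧ e.CutFree

/-- `d.HasWitness A t`: somewhere in `d` the succedent `∃x A(x)` is inferred from the succedent
`A(t)` by the rule introducing the existential quantifier in the succedent. -/
def HasWitness (A : Formula Sym 1) (t : ℕ) :
    {Γ : List (Formula Sym 0)} → {Λ : Option (Formula Sym 0)} → Derivation Γ Λ → Prop
  | _, _, .ax _ => False
  | _, _, .topR => False
  | _, _, .botL => False
  | _, _, .thinL _ d => d.HasWitness A t
  | _, _, .thinR _ d => d.HasWitness A t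
  | _, _, .contr d => d.HasWitness A t
  | _, _, .exch d => d.HasWitness A t
  | _, _, .cut d e => d.HasWitness A t ∨ e.HasWitness A t
  | _, _, .andR d e => d.HasWitness A t ∨ e.HasWitness A t
  | _, _, .andL₁ _ d => d.HasWitness A t
  | _, _, .andL₂ _ d => d.HasWitness A t
  | _, _, .orL d e => d.HasWitness A t ∨ e.HasWitness A t
  | _, _, .orR₁ _ d => d.HasWitness A t
  | _, _, .orR₂ _ d => d.HasWitness A t
  | _, _, .negR d => d.HasWitness A t
  | _, _, .negL d => d.HasWitness A t
  | _, _, .impR d => d.HasWitness A t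
  | _, _, .impL d e => d.HasWitness A t ∨ e.HasWitness A t
  | _, _, .allR _ _ _ _ d => d.HasWitness A t
  | _, _, .allL _ _ d => d.HasWitness A t
  | _, _, .exR F a d => (F = A ∧ a = t) ∨ d.HasWitness A t
  | _, _, .exL _ _ _ _ _ d => d.HasWitness A t
  | _, _, .neutralization _ _ d e => d.HasWitness A t ∨ e.HasWitness A t

end Derivation

/-- The formula `A` is derivable in LJ+: the sequent with empty antecedent and succedent `A` has a
derivation. -/
def Derivable (A : Formula Sym 0) : Prop :=
  Nonempty (Derivation [] (some A))

end LJPlus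

/-! In a cut-free derivation of `⊢ ∃x A(x)`, follow upwards the sequents whose succedent is still
`∃x A(x)`. Their antecedents are propositional: the first is empty, left rules expose only
subformulas, and neutralization adds only `N` or `¬N`. Hence neither the axiom `∃x A(x) ⊢ ∃x A(x)`
nor a quantifier rule on the left occurs among them, and `∃x A(x)` enters either by thinning or from
some `A(t)`. Replacing it by the disjunction of the collected instances gives a derivation of that
disjunction (`Derivation.exists_disj_of_cutFree`). Some instance is collected, since the empty
sequent is not derivable (`Derivation.consistent`).

Cut is eliminated semantically. Formulas are interpreted by sets of contexts closed with respect to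
cut-free provability. Every derivation, cuts included, is sound for this interpretation
(`Derivation.forced_sound`), and a context in the interpretation of `A` proves `A` without cut
(`Formula.forced_adequate`). Neutralization is sound because membership in a closed set is tested by
cut-free sequents with arbitrary side formulas and succedent, to which the rule itself applies. -/

namespace LJPlus

/-! ### Cut elimination through a model of closed sets of contexts -/

section CutElimination

variable {Sym : ℕ → Type*}

/-! ### Substitution of free variables -/

/-- Rename the free variables along `σ`. -/
def Var.subst (σ : ℕ → ℕ) {n : ℕ} : Var n → Var n
  | .free b => .free (σ b)
  | .bound i => .bound i

namespace Formula

/-- Rename the free variables along `σ`. -/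
def subst (σ : ℕ → ℕ) : {n : ℕ} → Formula Sym n → Formula Sym n
  | _, .atom R v => .atom R (fun i => (v i).subst σ)
  | _, .top => .top
  | _, .bot => .bot
  | _, .and A B => .and (A.subst σ) (B.subst σ)
  | _, .or A B => .or (A.subst σ) (B.subst σ)
  | _, .neg A => .neg (A.subst σ)
  | _, .imp A B => .imp (A.subst σ) (B.subst σ)
  | _, .all A => .all (A.subst σ)
  | _, .ex A => .ex (A.subst σ)

/-- The number of logical symbols. -/
def size : {n : ℕ} → Formula Sym n → ℕ
  | _, .atom _ _ => 0
  | _, .top => 0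
  | _, .bot => 0
  | _, .and A B => A.size + B.size + 1
  | _, .or A B => A.size + B.size + 1
  | _, .neg A => A.size + 1
  | _, .imp A B => A.size + B.size + 1
  | _, .all A => A.size + 1
  | _, .ex A => A.size + 1

end Formula

theorem Var.subst_inst (σ : ℕ → ℕ) (a : ℕ) {n : ℕ} (x : Var (n + 1)) :
    (x.inst a).subst σ = (x.subst σ).inst (σ a) := by
  cases x with
  | free b => rfl
  | bound i => cases i using Fin.cases <;> rfl

namespace Formula

/-- Induction on a formula needs a variable index, so `n + 1` is replaced by `m` together with an
equation. The size is the measure for recursion into the instances `F.inst t`, which are not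
subterms of the quantified formula. -/
theorem size_inst_aux (a : ℕ) {m : ℕ} (A : Formula Sym m) :
    ∀ (n : ℕ) (h : m = n + 1), ((h ▸ A : Formula Sym (n + 1)).inst a).size = A.size := by
  induction A with
  | atom | top | bot => intro n h; subst h; simp [inst, size]
  | and A B ihA ihB | or A B ihA ihB | imp A B ihA ihB =>
    intro n h; subst h; simpa [inst, size] using congrArg₂ (· + ·) (ihA n rfl) (ihB n rfl)
  | neg A ih => intro n h; subst h; simpa [inst, size] using ih n rfl
  | all A ih | ex A ih => intro n h; subst h; simpa [inst, size] using ih (n + 1) rfl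

@[simp]
theorem size_inst (a : ℕ) {n : ℕ} (A : Formula Sym (n + 1)) : (A.inst a).size = A.size :=
  size_inst_aux a A n rfl

theorem subst_inst_aux (σ : ℕ → ℕ) (a : ℕ) {m : ℕ} (A : Formula Sym m) :
    ∀ (n : ℕ) (h : m = n + 1), ((h ▸ A : Formula Sym (n + 1)).inst a).subst σ =
      ((h ▸ A : Formula Sym (n + 1)).subst σ).inst (σ a) := by
  induction A with
  | atom => intro n h; subst h; simp [inst, subst, Var.subst_inst]
  | top | bot => intro n h; subst h; simp [inst, subst]
  | and A B ihA ihB | or A B ihA ihB | imp A B ihA ihB =>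
    intro n h; subst h; simpa [inst, subst] using ⟨ihA n rfl, ihB n rfl⟩
  | neg A ih => intro n h; subst h; simpa [inst, subst] using ih n rfl
  | all A ih | ex A ih => intro n h; subst h; simpa [inst, subst] using ih (n + 1) rfl

theorem subst_inst (σ : ℕ → ℕ) (a : ℕ) {n : ℕ} (A : Formula Sym (n + 1)) :
    (A.inst a).subst σ = (A.subst σ).inst (σ a) :=
  subst_inst_aux σ a A n rfl

theorem subst_congr {σ τ : ℕ → ℕ} {n : ℕ} (A : Formula Sym n)
    (h : ∀ a, A.Occurs a → σ a = τ a) : A.subst σ = A.subst τ := by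
  induction A with
  | atom R v =>
    simp only [subst, atom.injEq, heq_eq_eq, true_and]
    funext i
    cases hv : v i with
    | free b => exact congrArg Var.free (h b ⟨i, hv⟩)
    | bound j => rfl
  | top | bot => rfl
  | and A B ihA ihB | or A B ihA ihB | imp A B ihA ihB =>
    simp only [subst]
    rw [ihA fun a ha => h a (Or.inl ha), ihB fun a ha => h a (Or.inr ha)]
  | neg A ih | all A ih | ex A ih =>
    simp only [subst]
    rw [ih h]

theorem subst_update (σ : ℕ → ℕ) {a t : ℕ} {n : ℕ} {A : Formula Sym n} (h : ¬ A.Occurs a) :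
    A.subst (Function.update σ a t) = A.subst σ :=
  A.subst_congr fun _ hb => Function.update_of_ne (by rintro rfl; exact h hb) _ _

@[simp]
theorem subst_id {n : ℕ} (A : Formula Sym n) : A.subst id = A := by
  induction A with
  | atom R v =>
    simp only [subst, atom.injEq, heq_eq_eq, true_and]
    funext i
    cases v i <;> rfl
  | top | bot => rfl
  | and A B ihA ihB | or A B ihA ihB | imp A B ihA ihB => simp only [subst, ihA, ihB]
  | neg A ih | all A ih | ex A ih => simp only [subst, ih]

theorem IsPropositional.subst (σ : ℕ → ℕ) {n : ℕ} {A : Formula Sym n} (h : A.IsPropositional) :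
    (A.subst σ).IsPropositional := by
  induction A with
  | atom => exact h
  | top | bot => trivial
  | and A B ihA ihB | or A B ihA ihB | imp A B ihA ihB => exact ⟨ihA h.1, ihB h.2⟩
  | neg A ih => exact ih h
  | all A | ex A => exact h.elim

theorem exists_bound_occurs {n : ℕ} (A : Formula Sym n) : ∃ b, ∀ a, A.Occurs a → a < b := by
  induction A with
  | @atom n k R v =>
    let f : Var n → ℕ := fun x => Var.casesOn x id fun _ => 0
    refine ⟨(Finset.univ.sup fun i => f (v i)) + 1, ?_⟩
    rintro a ⟨i, hi⟩
    have := Finset.le_sup (f := fun i => f (v i)) (Finset.mem_univ i)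
    simp only [hi, f, id] at this
    exact Nat.lt_succ_of_le this
  | top | bot => exact ⟨0, fun _ h => h.elim⟩
  | and A B ihA ihB | or A B ihA ihB | imp A B ihA ihB =>
    obtain ⟨b, hb⟩ := ihA
    obtain ⟨c, hc⟩ := ihB
    refine ⟨max b c, fun a h => ?_⟩
    rcases h with h | h
    · exact lt_max_of_lt_left (hb a h)
    · exact lt_max_of_lt_right (hc a h)
  | neg A ih | all A ih | ex A ih => exact ih

end Formula

theorem exists_bound_occurs_list (Γ : List (Formula Sym 0)) :
    ∃ b, ∀ G ∈ Γ, ∀ a, G.Occurs a → a < b := by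
  induction Γ with
  | nil => exact ⟨0, by simp⟩
  | cons G Γ ih =>
    obtain ⟨b, hb⟩ := ih
    obtain ⟨c, hc⟩ := G.exists_bound_occurs
    refine ⟨max b c, fun H hH a ha => ?_⟩
    rcases List.mem_cons.1 hH with rfl | hH
    · exact lt_max_of_lt_right (hc a ha)
    · exact lt_max_of_lt_left (hb H hH a ha)

/-- Supplies the eigenvariables for `allR` and `exL`. -/
theorem exists_fresh (F : Formula Sym 1) (Γ : List (Formula Sym 0)) :
    ∃ a, ¬ F.Occurs a ∧ ∀ G ∈ Γ, ¬ G.Occurs a := by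
  obtain ⟨b, hb⟩ := exists_bound_occurs_list Γ
  obtain ⟨c, hc⟩ := F.exists_bound_occurs
  exact ⟨max b c, fun h => (hc _ h).not_ge (le_max_right _ _),
    fun G hG h => (hb G hG _ h).not_ge (le_max_left _ _)⟩

/-! ### Cut-free provability -/

/-- The sequent `Γ ⊢ Λ` has a derivation without cut. -/
def CutFreeProvable (Γ : List (Formula Sym 0)) (Λ : Option (Formula Sym 0)) : Prop :=
  ∃ d : Derivation Γ Λ, d.CutFree

namespace CutFreeProvable

variable {Γ Δ : List (Formula Sym 0)} {Λ : Option (Formula Sym 0)} {A B : Formula Sym 0}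

theorem thinL (A : Formula Sym 0) : CutFreeProvable Γ Λ → CutFreeProvable (A :: Γ) Λ
  | ⟨d, h⟩ => ⟨d.thinL A, h⟩

/-- The prefix `Θ` is general so that the induction on permutations can move a common head into it;
exchange acts behind any prefix. -/
theorem perm_append (h : Γ.Perm Δ) : ∀ Θ : List (Formula Sym 0),
    CutFreeProvable (Θ ++ Γ) Λ → CutFreeProvable (Θ ++ Δ) Λ := by
  induction h with
  | nil => exact fun _ => id
  | cons G _ ih => intro Θ hΘ; simpa using ih (Θ ++ [G]) (by simpa using hΘ)
  | swap => rintro Θ ⟨d, hd⟩; exact ⟨d.exch, hd⟩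
  | trans _ _ ih₁ ih₂ => exact fun Θ hΘ => ih₂ Θ (ih₁ Θ hΘ)

theorem perm (h : Γ.Perm Δ) (hΓ : CutFreeProvable Γ Λ) : CutFreeProvable Δ Λ :=
  perm_append h [] hΓ

theorem contr_of_mem (h : A ∈ Γ) (hΓ : CutFreeProvable (A :: Γ) Λ) : CutFreeProvable Γ Λ := by
  obtain ⟨s, t, rfl⟩ := List.append_of_mem h
  have hp : (s ++ A :: t).Perm (A :: (s ++ t)) := List.perm_middle
  obtain ⟨d, hd⟩ := hΓ.perm (hp.cons A)
  exact CutFreeProvable.perm hp.symm ⟨d.contr, hd⟩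

theorem contr_append : ∀ Θ : List (Formula Sym 0), Θ ⊆ Γ →
    CutFreeProvable (Θ ++ Γ) Λ → CutFreeProvable Γ Λ
  | [], _, h => h
  | _ :: Θ, hs, h =>
    contr_append Θ (fun _ hx => hs (List.mem_cons_of_mem _ hx))
      (h.contr_of_mem (List.mem_append_right _ (hs List.mem_cons_self)))

theorem thin_append (hΓ : CutFreeProvable Γ Λ) : ∀ Θ : List (Formula Sym 0),
    CutFreeProvable (Θ ++ Γ) Λ
  | [] => hΓ
  | A :: Θ => (thin_append hΓ Θ).thinL A

/-- Thin by all of `Δ`, then contract the formulas of `Γ` into it. Thus only the set of antecedent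
formulas matters. -/
theorem mono (h : Γ ⊆ Δ) (hΓ : CutFreeProvable Γ Λ) : CutFreeProvable Δ Λ :=
  contr_append Γ h ((hΓ.thin_append Δ).perm List.perm_append_comm)

theorem of_none (h : CutFreeProvable Γ none) : ∀ Λ, CutFreeProvable Γ Λ
  | none => h
  | some A => let ⟨d, hd⟩ := h; ⟨d.thinR A, hd⟩

end CutFreeProvable

/-! ### Closed sets of contexts -/

/-- The least set of contexts containing `X` that is an intersection of sets of the form
`{Γ | Γ, Δ ⊢ Λ}`, where `⊢` is cut-free provability. -/
def contextClosure (X : Set (List (Formula Sym 0))) : Set (List (Formula Sym 0)) :=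
  {Γ | ∀ Δ Λ, (∀ Γ' ∈ X, CutFreeProvable (Γ' ++ Δ) Λ) → CutFreeProvable (Γ ++ Δ) Λ}

theorem subset_contextClosure (X : Set (List (Formula Sym 0))) : X ⊆ contextClosure X :=
  fun Γ h _ _ H => H Γ h

/-- A set of contexts is closed if it contains its closure. -/
def IsContextClosed (X : Set (List (Formula Sym 0))) : Prop :=
  contextClosure X ⊆ X

theorem isContextClosed_contextClosure (X : Set (List (Formula Sym 0))) :
    IsContextClosed (contextClosure X) :=
  fun _ h Δ Λ H => h Δ Λ fun _ h' => h' Δ Λ H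

theorem isContextClosed_provable (Λ : Option (Formula Sym 0)) :
    IsContextClosed {Γ | CutFreeProvable Γ Λ} := fun Γ h => by
  simpa using h [] Λ (by simp)

namespace IsContextClosed

variable {X Y : Set (List (Formula Sym 0))} {Γ Δ Θ : List (Formula Sym 0)}

theorem mem_of_imp (hX : IsContextClosed X) (hΓ : Γ ∈ X)
    (h : ∀ Θ Λ, CutFreeProvable (Γ ++ Θ) Λ → CutFreeProvable (Δ ++ Θ) Λ) : Δ ∈ X :=
  hX fun Θ Λ H => h Θ Λ (H Γ hΓ)

theorem mono (hX : IsContextClosed X) (h : Γ ⊆ Δ) (hΓ : Γ ∈ X) : Δ ∈ X :=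
  hX.mem_of_imp hΓ fun Θ _ H => H.mono (List.append_subset.2
    ⟨fun _ hx => List.mem_append_left Θ (h hx), List.subset_append_right _ _⟩)

/-- Testing the closure at `Θ ++ Δ` instead of `Δ` lets `Θ` accompany each `Γ ∈ X`; the second copy
of `Θ` is contracted. This is the elimination principle behind `orL` and `exL`. -/
theorem bind (hY : IsContextClosed Y) (hΘ : Θ ∈ contextClosure X)
    (h : ∀ Γ ∈ X, Θ ++ Γ ∈ Y) : Θ ∈ Y := by
  refine hY fun Δ Λ H => ?_
  have := hΘ (Θ ++ Δ) Λ fun Γ hΓ => (H _ (h Γ hΓ)).mono (by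
    intro x; simp only [List.mem_append]; tauto)
  exact this.mono (by intro x; simp only [List.mem_append]; tauto)

end IsContextClosed

/-! ### Interpretation of formulas by closed sets of contexts -/

namespace Formula

/-- The closed set of contexts that interprets a formula. -/
def forced : Formula Sym 0 → Set (List (Formula Sym 0))
  | .atom R v => {Γ | CutFreeProvable Γ (some (.atom R v))}
  | .top => Set.univ
  | .bot => {Γ | CutFreeProvable Γ none}
  | .and A B => A.forced ∩ B.forced
  | .or A B => contextClosure (A.forced ∪ B.forced)
  | .neg A => {Γ | ∀ Γ' ∈ A.forced, CutFreeProvable (Γ ++ Γ') none}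
  | .imp A B => {Γ | ∀ Γ' ∈ A.forced, Γ ++ Γ' ∈ B.forced}
  | .all F => ⋂ t, (F.inst t).forced
  | .ex F => contextClosure (⋃ t, (F.inst t).forced)
  termination_by A => A.size
  decreasing_by all_goals simp only [size, size_inst]; omega

end Formula

/-- The closed set of contexts that interprets a succedent. -/
def forcedSuccedent : Option (Formula Sym 0) → Set (List (Formula Sym 0))
  | none => {Γ | CutFreeProvable Γ none}
  | some A => A.forced

/-- Closed sets are stable under intersection. For negation and implication the argument `Γ'` is
absorbed into the side context of the test. -/
theorem Formula.isContextClosed_forced (A : Formula Sym 0) : IsContextClosed A.forced := by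
  induction hn : A.size using Nat.strong_induction_on generalizing A with
  | _ n ih =>
  subst hn
  cases A with
  | atom R v => rw [forced]; exact isContextClosed_provable _
  | top => rw [forced]; exact Set.subset_univ _
  | bot => rw [forced]; exact isContextClosed_provable _
  | and A B =>
    rw [forced]
    exact fun Γ h => ⟨ih _ (by simp only [size]; omega) A rfl fun Δ Λ H => h Δ Λ fun Γ' h' => H Γ' h'.1,
      ih _ (by simp only [size]; omega) B rfl fun Δ Λ H => h Δ Λ fun Γ' h' => H Γ' h'.2⟩
  | or A B => rw [forced]; exact isContextClosed_contextClosure _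
  | neg A =>
    rw [forced]
    exact fun Γ h Γ' hΓ' => h Γ' none fun Δ hΔ => hΔ Γ' hΓ'
  | imp A B =>
    rw [forced]
    refine fun Γ h Γ' hΓ' => ih _ (by simp only [size]; omega) B rfl fun Δ Λ H => ?_
    rw [List.append_assoc]
    refine h _ _ fun Θ hΘ => ?_
    rw [← List.append_assoc]
    exact H _ (hΘ Γ' hΓ')
  | all F =>
    rw [forced]
    exact fun Γ h => Set.mem_iInter.2 fun t => ih _ (by simp only [size, size_inst]; omega) (F.inst t) rfl
      fun Δ Λ H => h Δ Λ fun Γ' h' => H Γ' (Set.mem_iInter.1 h' t)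
  | ex F => rw [forced]; exact isContextClosed_contextClosure _

theorem isContextClosed_forcedSuccedent :
    ∀ Λ : Option (Formula Sym 0), IsContextClosed (forcedSuccedent Λ)
  | none => isContextClosed_provable _
  | some A => A.isContextClosed_forced

/-- Every formula belongs to its interpretation, and is provable without cut from every context in
its interpretation. -/
theorem Formula.forced_adequate (A : Formula Sym 0) :
    [A] ∈ A.forced ∧ ∀ Γ ∈ A.forced, CutFreeProvable Γ (some A) := by
  induction hn : A.size using Nat.strong_induction_on generalizing A with
  | _ n ih =>
  subst hn
  cases A with
  | atom R v => rw [forced]; exact ⟨⟨.ax _, trivial⟩, fun _ => id⟩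
  | top =>
    rw [forced]
    exact ⟨trivial, fun Γ _ => CutFreeProvable.mono (List.nil_subset Γ) ⟨.topR, trivial⟩⟩
  | bot => rw [forced]; exact ⟨⟨.botL, trivial⟩, fun _ h => h.of_none _⟩
  | and A B =>
    obtain ⟨hA, hA'⟩ := ih _ (by simp only [size]; omega) A rfl
    obtain ⟨hB, hB'⟩ := ih _ (by simp only [size]; omega) B rfl
    rw [forced]
    refine ⟨⟨A.isContextClosed_forced.mem_of_imp hA ?_, B.isContextClosed_forced.mem_of_imp hB ?_⟩,
      fun Γ h => ?_⟩
    · rintro Θ Λ ⟨d, hd⟩; exact ⟨d.andL₁ B, hd⟩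
    · rintro Θ Λ ⟨d, hd⟩; exact ⟨d.andL₂ A, hd⟩
    · obtain ⟨d, hd⟩ := hA' Γ h.1
      obtain ⟨e, he⟩ := hB' Γ h.2
      exact ⟨d.andR e, hd, he⟩
  | or A B =>
    obtain ⟨hA, hA'⟩ := ih _ (by simp only [size]; omega) A rfl
    obtain ⟨hB, hB'⟩ := ih _ (by simp only [size]; omega) B rfl
    rw [forced]
    -- The contexts proving `A ∨ B` form a closed set, so it suffices that they include the union of
    -- the two interpretations.
    refine ⟨fun Δ Λ H => ?_, fun Γ h => isContextClosed_provable (some (.or A B))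
      fun Δ Λ H => h Δ Λ fun Γ' h' => H Γ' ?_⟩
    · obtain ⟨d, hd⟩ := H _ (Or.inl hA)
      obtain ⟨e, he⟩ := H _ (Or.inr hB)
      exact ⟨d.orL e, hd, he⟩
    · rcases h' with h' | h'
      · obtain ⟨d, hd⟩ := hA' _ h'
        exact ⟨d.orR₁ B, hd⟩
      · obtain ⟨d, hd⟩ := hB' _ h'
        exact ⟨d.orR₂ A, hd⟩
  | neg A =>
    obtain ⟨hA, hA'⟩ := ih _ (by simp only [size]; omega) A rfl
    rw [forced]
    refine ⟨fun Γ hΓ => ?_, fun Γ h => ?_⟩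
    · obtain ⟨d, hd⟩ := hA' Γ hΓ
      exact ⟨d.negL, hd⟩
    -- Since `[A]` lies in the interpretation of `A`, the semantic hypothesis applies to the context
    -- `[A]` and yields the premise of `negR`.
    · obtain ⟨d, hd⟩ := (h _ hA).perm List.perm_append_comm
      exact ⟨d.negR, hd⟩
  | imp A B =>
    obtain ⟨hA, hA'⟩ := ih _ (by simp only [size]; omega) A rfl
    obtain ⟨hB, hB'⟩ := ih _ (by simp only [size]; omega) B rfl
    rw [forced]
    refine ⟨fun Γ hΓ => B.isContextClosed_forced.mem_of_imp hB ?_, fun Γ h => ?_⟩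
    · rintro Θ Λ ⟨e, he⟩
      obtain ⟨d, hd⟩ := hA' Γ hΓ
      exact ⟨d.impL e, hd, he⟩
    · obtain ⟨d, hd⟩ := (hB' _ (h _ hA)).perm List.perm_append_comm
      exact ⟨d.impR, hd⟩
  | all F =>
    have ih' := fun t => ih _ (by simp only [size, size_inst]; omega) (F.inst t) rfl
    rw [forced]
    refine ⟨Set.mem_iInter.2 fun t => (F.inst t).isContextClosed_forced.mem_of_imp (ih' t).1 ?_,
      fun Γ h => ?_⟩
    · rintro Θ Λ ⟨d, hd⟩; exact ⟨d.allL F t, hd⟩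
    · obtain ⟨a, hF, hΓ⟩ := exists_fresh F Γ
      obtain ⟨d, hd⟩ := (ih' a).2 Γ (Set.mem_iInter.1 h a)
      exact ⟨d.allR F a hΓ hF, hd⟩
  | ex F =>
    have ih' := fun t => ih _ (by simp only [size, size_inst]; omega) (F.inst t) rfl
    rw [forced]
    refine ⟨fun Δ Λ H => ?_, fun Γ h => isContextClosed_provable (some (.ex F))
      fun Δ Λ H => h Δ Λ fun Γ' h' => H Γ' ?_⟩
    · obtain ⟨a, hF, hΓ⟩ := exists_fresh F (Λ.toList ++ Δ)
      obtain ⟨d, hd⟩ := H _ (Set.mem_iUnion.2 ⟨a, (ih' a).1⟩)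
      exact ⟨d.exL F a hF (fun G hG => hΓ G (List.mem_append_right _ hG))
        (fun G hG => hΓ G (List.mem_append_left _ (Option.mem_toList.2 hG))), hd⟩
    · obtain ⟨t, ht⟩ := Set.mem_iUnion.1 h'
      obtain ⟨d, hd⟩ := (ih' t).2 Γ' ht
      exact ⟨d.exR F t, hd⟩

/-- Quantifying over all renamings `σ` lets an eigenvariable take any value. Cut becomes mere
composition: what the left premise puts into the interpretation of the cut formula is fed to the
right one. -/
theorem Derivation.forced_sound {Γ : List (Formula Sym 0)} {Λ : Option (Formula Sym 0)}
    (d : Derivation Γ Λ) : ∀ (σ : ℕ → ℕ) (Θ : List (Formula Sym 0)),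
      (∀ G ∈ Γ, Θ ∈ (G.subst σ).forced) → Θ ∈ forcedSuccedent (Λ.map (Formula.subst σ)) := by
  have left {Θ Γ' : List (Formula Sym 0)} {G : Formula Sym 0} (h : Θ ∈ G.forced) :
      Θ ++ Γ' ∈ G.forced := G.isContextClosed_forced.mono (List.subset_append_left _ _) h
  have right {Θ Γ' : List (Formula Sym 0)} {G : Formula Sym 0} (h : Γ' ∈ G.forced) :
      Θ ++ Γ' ∈ G.forced := G.isContextClosed_forced.mono (List.subset_append_right _ _) h
  induction d with
  | ax A => intro σ Θ h; exact h A (by simp)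
  | topR => intro σ Θ h; simp [forcedSuccedent, Formula.subst, Formula.forced]
  | botL => intro σ Θ h; simpa [forcedSuccedent, Formula.subst, Formula.forced] using h .bot
  | thinL A d ih => intro σ Θ h; exact ih σ Θ fun G hG => h G (List.mem_cons_of_mem _ hG)
  | thinR A d ih =>
    intro σ Θ h
    have h0 : CutFreeProvable Θ none := ih σ Θ h
    -- A context proving the empty succedent proves every succedent, so it passes every test and
    -- lies in every closed set.
    exact isContextClosed_forcedSuccedent _ fun Δ Λ _ => CutFreeProvable.of_none
      (h0.mono (List.subset_append_left _ _)) Λ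
  | contr d ih => intro σ Θ h; exact ih σ Θ fun G hG => h G (by simpa using hG)
  | exch d ih =>
    intro σ Θ h
    refine ih σ Θ fun G hG => h G ?_
    simp only [List.mem_append, List.mem_cons] at hG ⊢
    tauto
  | cut d e ihd ihe =>
    intro σ Θ h
    refine ihe σ Θ (List.forall_mem_cons.2 ⟨ihd σ Θ fun G hG => h G (List.mem_append_left _ hG),
      fun G hG => h G (List.mem_append_right _ hG)⟩)
  | andR d e ihd ihe =>
    intro σ Θ h
    simp only [forcedSuccedent, Option.map_some, Formula.subst, Formula.forced]
    exact ⟨ihd σ Θ h, ihe σ Θ h⟩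
  | andL₁ B d ih =>
    intro σ Θ h
    simp only [List.forall_mem_cons, Formula.subst, Formula.forced] at h
    exact ih σ Θ (List.forall_mem_cons.2 ⟨h.1.1, h.2⟩)
  | andL₂ A d ih =>
    intro σ Θ h
    simp only [List.forall_mem_cons, Formula.subst, Formula.forced] at h
    exact ih σ Θ (List.forall_mem_cons.2 ⟨h.1.2, h.2⟩)
  | orL d e ihd ihe =>
    intro σ Θ h
    simp only [List.forall_mem_cons, Formula.subst, Formula.forced] at h
    refine (isContextClosed_forcedSuccedent _).bind h.1 fun Γ' hΓ' => ?_
    rcases hΓ' with hΓ' | hΓ'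
    · exact ihd σ _ (List.forall_mem_cons.2 ⟨right hΓ', fun G hG => left (h.2 G hG)⟩)
    · exact ihe σ _ (List.forall_mem_cons.2 ⟨right hΓ', fun G hG => left (h.2 G hG)⟩)
  | orR₁ B d ih =>
    intro σ Θ h
    simp only [forcedSuccedent, Option.map_some, Formula.subst, Formula.forced]
    exact subset_contextClosure _ (Or.inl (ih σ Θ h))
  | orR₂ A d ih =>
    intro σ Θ h
    simp only [forcedSuccedent, Option.map_some, Formula.subst, Formula.forced]
    exact subset_contextClosure _ (Or.inr (ih σ Θ h))
  | negR d ih =>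
    intro σ Θ h
    simp only [forcedSuccedent, Option.map_some, Formula.subst, Formula.forced]
    exact fun Γ' hΓ' => ih σ _ (List.forall_mem_cons.2 ⟨right hΓ', fun G hG => left (h G hG)⟩)
  | negL d ih =>
    intro σ Θ h
    simp only [List.forall_mem_cons, Formula.subst, Formula.forced] at h
    exact (h.1 Θ (ih σ Θ h.2)).mono (by simp)
  | impR d ih =>
    intro σ Θ h
    simp only [forcedSuccedent, Option.map_some, Formula.subst, Formula.forced]
    exact fun Γ' hΓ' => ih σ _ (List.forall_mem_cons.2 ⟨right hΓ', fun G hG => left (h G hG)⟩)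
  | impL d e ihd ihe =>
    intro σ Θ h
    simp only [List.forall_mem_cons, Formula.subst, Formula.forced] at h
    have hA := ihd σ Θ fun G hG => h.2 G (List.mem_append_left _ hG)
    exact ihe σ Θ (List.forall_mem_cons.2
      ⟨(Formula.isContextClosed_forced _).mono (by simp) (h.1 Θ hA),
        fun G hG => h.2 G (List.mem_append_right _ hG)⟩)
  | allR F a hΓ hF d ih =>
    intro σ Θ h
    simp only [forcedSuccedent, Option.map_some, Formula.subst, Formula.forced]
    refine Set.mem_iInter.2 fun t => ?_
    -- Sending the eigenvariable to `t` leaves the antecedent and `F` unchanged.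
    have := ih (Function.update σ a t) Θ fun G hG => by
      rw [Formula.subst_update σ (hΓ G hG)]; exact h G hG
    simpa [forcedSuccedent, Formula.subst_inst, Formula.subst_update σ hF] using this
  | allL F a d ih =>
    intro σ Θ h
    simp only [List.forall_mem_cons, Formula.subst, Formula.forced] at h
    refine ih σ Θ (List.forall_mem_cons.2 ⟨?_, h.2⟩)
    rw [Formula.subst_inst]
    exact Set.mem_iInter.1 h.1 _
  | exR F a d ih =>
    intro σ Θ h
    simp only [forcedSuccedent, Option.map_some, Formula.subst, Formula.forced]
    refine subset_contextClosure _ (Set.mem_iUnion.2 ⟨σ a, ?_⟩)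
    rw [← Formula.subst_inst]
    exact ih σ Θ h
  | @exL Γ Λ F a hF hΓ hΛ d ih =>
    intro σ Θ h
    simp only [List.forall_mem_cons, Formula.subst, Formula.forced] at h
    refine (isContextClosed_forcedSuccedent _).bind h.1 fun Γ' hΓ' => ?_
    obtain ⟨t, ht⟩ := Set.mem_iUnion.1 hΓ'
    have := ih (Function.update σ a t) (Θ ++ Γ') (List.forall_mem_cons.2 ⟨?_, fun G hG => ?_⟩)
    · have e : Λ.map (Formula.subst (Function.update σ a t)) = Λ.map (Formula.subst σ) :=
        Option.map_congr fun G hG => Formula.subst_update σ (hΛ G hG)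
      rwa [e] at this
    · rw [Formula.subst_inst, Formula.subst_update σ hF, Function.update_self]
      exact right ht
    · rw [Formula.subst_update σ (hΓ G hG)]
      exact left (h.2 G hG)
  | neutralization N hN d e ihd ihe =>
    intro σ Θ h
    refine isContextClosed_forcedSuccedent _ fun Δ Λ' H => ?_
    -- By adequacy `N` and `¬N` lie in their own interpretations, so each premise gives a cut-free
    -- derivation of the test sequent with one of them added.
    obtain ⟨d', hd'⟩ := H ([N.subst σ] ++ Θ) (ihd σ _ (List.forall_mem_cons.2
      ⟨left (N.subst σ).forced_adequate.1, fun G hG => right (h G hG)⟩))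
    obtain ⟨e', he'⟩ := H ([.neg (N.subst σ)] ++ Θ) (ihe σ _ (List.forall_mem_cons.2
      ⟨by rw [Formula.subst]; exact left (Formula.neg (N.subst σ)).forced_adequate.1,
        fun G hG => right (h G hG)⟩))
    exact ⟨.neutralization _ (hN.subst σ) d' e', hd', he'⟩

/-- Cut elimination for LJ+, for sequents with empty antecedent. -/
theorem Derivable.cutFreeProvable {A : Formula Sym 0} (h : Derivable A) :
    CutFreeProvable [] (some A) := by
  obtain ⟨d⟩ := h
  refine A.forced_adequate.2 [] ?_
  simpa [forcedSuccedent] using d.forced_sound id [] (by simp)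

end CutElimination

/-! ### Consistency by a one-element classical model -/

section Consistency

variable {Sym : ℕ → Type*}

/-- The truth value of a formula in the structure with one element in which all atoms hold. -/
def Formula.TrivialTruth : {n : ℕ} → Formula Sym n → Prop
  | _, .atom _ _ => True
  | _, .top => True
  | _, .bot => False
  | _, .and A B => A.TrivialTruth ∧ B.TrivialTruth
  | _, .or A B => A.TrivialTruth ∨ B.TrivialTruth
  | _, .neg A => ¬ A.TrivialTruth
  | _, .imp A B => A.TrivialTruth → B.TrivialTruth
  | _, .all A => A.TrivialTruth
  | _, .ex A => A.TrivialTruth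

theorem Formula.trivialTruth_inst_aux (a : ℕ) {m : ℕ} (A : Formula Sym m) :
    ∀ (n : ℕ) (h : m = n + 1),
      ((h ▸ A : Formula Sym (n + 1)).inst a).TrivialTruth ↔ A.TrivialTruth := by
  induction A with
  | atom | top | bot => intro n h; subst h; simp [inst, TrivialTruth]
  | and A B ihA ihB =>
    intro n h; subst h
    simpa only [inst, TrivialTruth] using and_congr (ihA n rfl) (ihB n rfl)
  | or A B ihA ihB =>
    intro n h; subst h
    simpa only [inst, TrivialTruth] using or_congr (ihA n rfl) (ihB n rfl)
  | imp A B ihA ihB =>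
    intro n h; subst h
    simpa only [inst, TrivialTruth] using imp_congr (ihA n rfl) (ihB n rfl)
  | neg A ih =>
    intro n h; subst h
    simpa only [inst, TrivialTruth] using not_congr (ih n rfl)
  | all A ih | ex A ih =>
    intro n h; subst h
    simpa only [inst, TrivialTruth] using ih (n + 1) rfl

@[simp]
theorem Formula.trivialTruth_inst (a : ℕ) {n : ℕ} (A : Formula Sym (n + 1)) :
    (A.inst a).TrivialTruth ↔ A.TrivialTruth :=
  A.trivialTruth_inst_aux a n rfl

/-- Truth values are classical, so neutralization is sound by excluded middle; with a single
element, variables and quantifiers have no effect. -/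
theorem Derivation.trivialTruth_sound {Γ : List (Formula Sym 0)} {Λ : Option (Formula Sym 0)}
    (d : Derivation Γ Λ) : (∀ G ∈ Γ, G.TrivialTruth) → ∃ G ∈ Λ, G.TrivialTruth := by
  induction d
  case neutralization N _ _ _ ihd ihe =>
    intro h
    by_cases hN : N.TrivialTruth
    · exact ihd (List.forall_mem_cons.2 ⟨hN, h⟩)
    · exact ihe (List.forall_mem_cons.2 ⟨hN, h⟩)
  all_goals
    simp_all only [List.forall_mem_cons, List.forall_mem_append, Option.mem_def, Option.some.injEq,
      exists_eq_left', Formula.TrivialTruth, Formula.trivialTruth_inst, reduceCtorEq, false_and,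
      exists_false, imp_false, and_imp]
    try grind

theorem Derivation.consistent (d : Derivation ([] : List (Formula Sym 0)) none) : False := by
  simpa using d.trivialTruth_sound (by simp)

end Consistency

/-! ### Reading off the disjunction from a cut-free derivation -/

section Witnesses

variable {Sym : ℕ → Type*}

/-- The disjunction of the instances of `A` as a succedent, which is empty for the empty list. -/
def disjSuccedent (A : Formula Sym 1) : List ℕ → Option (Formula Sym 0)
  | [] => none
  | t :: ts => some (A.disj t ts)

theorem Derivation.disj_of_mem {A : Formula Sym 1} {Γ : List (Formula Sym 0)} {s : ℕ}
    (d : Derivation Γ (some (A.inst s))) : ∀ {L : List ℕ}, s ∈ L →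
      Nonempty (Derivation Γ (disjSuccedent A L))
  | [t], h => by obtain rfl := List.mem_singleton.1 h; exact ⟨d⟩
  | t :: t' :: ts, h => by
    rcases List.mem_cons.1 h with rfl | h
    · exact ⟨d.orR₁ _⟩
    · obtain ⟨e⟩ := d.disj_of_mem h
      exact ⟨Derivation.orR₂ _ e⟩

theorem disj_entails {A : Formula Sym 1} {L : List ℕ} : ∀ (t : ℕ) (ts : List ℕ), t :: ts ⊆ L →
    Nonempty (Derivation [A.disj t ts] (disjSuccedent A L))
  | t, [], h => (Derivation.ax _).disj_of_mem (h List.mem_cons_self)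
  | t, s :: ts, h => by
    obtain ⟨d⟩ := (Derivation.ax (A.inst t)).disj_of_mem (h List.mem_cons_self)
    obtain ⟨e⟩ := disj_entails s ts fun _ hx => h (List.mem_cons_of_mem _ hx)
    exact ⟨d.orL e⟩

/-- Brings the premises of a two-premise rule to a common succedent. Cut may be used here, since the
derivation of the disjunction need not be cut-free. -/
theorem Derivation.disj_mono {A : Formula Sym 1} {Γ : List (Formula Sym 0)} {L L' : List ℕ}
    (d : Derivation Γ (disjSuccedent A L)) (h : L ⊆ L') :
    Nonempty (Derivation Γ (disjSuccedent A L')) := by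
  cases L with
  | nil =>
    cases L' with
    | nil => exact ⟨d⟩
    | cons t ts => exact ⟨d.thinR _⟩
  | cons t ts =>
    obtain ⟨e⟩ := disj_entails t ts h
    simpa using Nonempty.intro (d.cut e)

/-- A cut-free derivation of `Γ ⊢ ∃x A(x)` with `Γ` propositional yields a derivation of the
disjunction of the instances of `A` that it introduces. -/
theorem Derivation.exists_disj_of_cutFree (A : Formula Sym 1) {Γ : List (Formula Sym 0)}
    {Λ : Option (Formula Sym 0)} (d : Derivation Γ Λ) (hd : d.CutFree)
    (hΓ : ∀ G ∈ Γ, G.IsPropositional) (hΛ : Λ = some (.ex A)) :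
    ∃ L : List ℕ, (∀ s ∈ L, d.HasWitness A s) ∧ Nonempty (Derivation Γ (disjSuccedent A L)) := by
  induction d with
  | ax B =>
    cases hΛ
    -- The antecedent would be `∃x A(x)`, which is not propositional.
    exact (hΓ _ List.mem_cons_self).elim
  | topR => cases hΛ
  | botL => cases hΛ
  | thinL B d ih =>
    obtain ⟨L, hL, ⟨e⟩⟩ := ih hd (List.forall_mem_cons.1 hΓ).2 hΛ
    exact ⟨L, hL, ⟨e.thinL B⟩⟩
  -- Thinning introduces `∃x A(x)` without a witness, so the list is empty and the succedent stays
  -- empty.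
  | thinR B d => exact ⟨[], by simp, ⟨d⟩⟩
  | contr d ih =>
    obtain ⟨L, hL, ⟨e⟩⟩ := ih hd (fun G hG => hΓ G (by simpa using hG)) hΛ
    exact ⟨L, hL, ⟨e.contr⟩⟩
  | exch d ih =>
    obtain ⟨L, hL, ⟨e⟩⟩ := ih hd (fun G hG => hΓ G (by
      simp only [List.mem_append, List.mem_cons] at hG ⊢; tauto)) hΛ
    exact ⟨L, hL, ⟨e.exch⟩⟩
  | cut => exact hd.elim
  | andR | orR₁ | orR₂ | negR | negL | impR | allR => cases hΛ
  | andL₁ B d ih =>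
    rw [List.forall_mem_cons] at hΓ
    obtain ⟨L, hL, ⟨e⟩⟩ := ih hd (List.forall_mem_cons.2 ⟨hΓ.1.1, hΓ.2⟩) hΛ
    exact ⟨L, hL, ⟨e.andL₁ B⟩⟩
  | andL₂ B d ih =>
    rw [List.forall_mem_cons] at hΓ
    obtain ⟨L, hL, ⟨e⟩⟩ := ih hd (List.forall_mem_cons.2 ⟨hΓ.1.2, hΓ.2⟩) hΛ
    exact ⟨L, hL, ⟨e.andL₂ B⟩⟩
  | orL d e ihd ihe =>
    rw [List.forall_mem_cons] at hΓ
    obtain ⟨L, hL, ⟨d'⟩⟩ := ihd hd.1 (List.forall_mem_cons.2 ⟨hΓ.1.1, hΓ.2⟩) hΛ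
    obtain ⟨M, hM, ⟨e'⟩⟩ := ihe hd.2 (List.forall_mem_cons.2 ⟨hΓ.1.2, hΓ.2⟩) hΛ
    obtain ⟨d''⟩ := d'.disj_mono (List.subset_append_left L M)
    obtain ⟨e''⟩ := e'.disj_mono (List.subset_append_right L M)
    exact ⟨L ++ M, List.forall_mem_append.2 ⟨fun s hs => Or.inl (hL s hs),
      fun s hs => Or.inr (hM s hs)⟩, ⟨d''.orL e''⟩⟩
  | impL d e ihd ihe =>
    rw [List.forall_mem_cons, List.forall_mem_append] at hΓ
    obtain ⟨M, hM, ⟨e'⟩⟩ := ihe hd.2 (List.forall_mem_cons.2 ⟨hΓ.1.2, hΓ.2.2⟩) hΛ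
    -- The left premise does not carry `∃x A(x)` down to the conclusion and is reused unchanged.
    exact ⟨M, fun s hs => Or.inr (hM s hs), ⟨d.impL e'⟩⟩
  | allL => exact (hΓ _ List.mem_cons_self).elim
  | exL => exact (hΓ _ List.mem_cons_self).elim
  | exR F a d =>
    cases hΛ
    exact ⟨[a], fun s hs => Or.inl ⟨rfl, (List.mem_singleton.1 hs).symm⟩, ⟨d⟩⟩
  | neutralization N hN d e ihd ihe =>
    obtain ⟨L, hL, ⟨d'⟩⟩ := ihd hd.1 (List.forall_mem_cons.2 ⟨hN, hΓ⟩) hΛ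
    obtain ⟨M, hM, ⟨e'⟩⟩ := ihe hd.2 (List.forall_mem_cons.2 ⟨hN, hΓ⟩) hΛ
    obtain ⟨d''⟩ := d'.disj_mono (List.subset_append_left L M)
    obtain ⟨e''⟩ := e'.disj_mono (List.subset_append_right L M)
    exact ⟨L ++ M, List.forall_mem_append.2 ⟨fun s hs => Or.inl (hL s hs),
      fun s hs => Or.inr (hM s hs)⟩, ⟨.neutralization N hN d'' e''⟩⟩

theorem Derivation.exists_derivable_disj (A : Formula Sym 1) (d : Derivation [] (some (.ex A)))
    (hd : d.CutFree) : ∃ (t : ℕ) (ts : List ℕ), (∀ s ∈ t :: ts, d.HasWitness A s) ∧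
      Derivable (A.disj t ts) := by
  obtain ⟨L, hL, ⟨e⟩⟩ := d.exists_disj_of_cutFree A hd (by simp) rfl
  cases L with
  -- An empty list would give a derivation of the empty sequent; this is where `n ≥ 1` comes from.
  | nil => exact e.consistent.elim
  | cons t ts => exact ⟨t, ts, hL, ⟨e⟩⟩

end Witnesses

end LJPlus

theorem mainTheorem6 {Sym : ℕ → Type*} (A : LJPlus.Formula Sym 1)
    (h : LJPlus.Derivable (.ex A)) :
    (∃ (t : ℕ) (ts : List ℕ), LJPlus.Derivable (A.disj t ts)) ∧
    (∃ d : LJPlus.Derivation [] (some (.ex A)), d.CutFree) ∧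
    (∀ d : LJPlus.Derivation [] (some (.ex A)), d.CutFree →
      ∃ (t : ℕ) (ts : List ℕ), (∀ s ∈ t :: ts, d.HasWitness A s) ∧
        LJPlus.Derivable (A.disj t ts)) := by
  obtain ⟨d, hd⟩ := h.cutFreeProvable
  refine ⟨?_, ⟨d, hd⟩, fun e he => e.exists_derivable_disj A he⟩
  obtain ⟨t, ts, -, ht⟩ := d.exists_derivable_disj A hd
  exact ⟨t, ts, ht⟩
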